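/- A forward-variant (front-to-back) pairing heap is either empty or a single rooted ordered tree with one key from a totally ordered set at each node. Linking two trees compares their roots and makes the tree with the greater root the leftmost child of the other root. Insert links a new one-node tree with the root (into an empty heap, the new node becomes the root). Delete-min removes the root, with children $x_1,\dots,x_k$ from left to right; it links $x_{2i-1}$ with $x_{2i}$ for $i=1,\dots,\lfloor k/2\rfloor$, which leaves trees $y_1,\dots,y_m$, $m=\lceil k/2\rceil$, in this order; then for $i=1,\dots,m-1$ it links the tree obtained so far from $y_1,\dots,y_i$ with $y_{i+1}$. On an empty heap delete-min does nothing. The actual cost of an operation is $1$ plus the number of links it performs. Write $\log$ for the binary logarithm, and let $g(n)=\log n\cdot 4^{\sqrt{\log n}}$ for $n\ge 2$ and $g(0)=g(1)=g(2)$. Theorem. In the forward variant of pairing heaps the amortized costs of insert and delete-min are $O(\log n\cdot 4^{\sqrt{\log n}})$, where $n$ is the number of items in the heap when the operation is performed. Precisely: there is an absolute constant $C>0$ such that for every totally ordered set of keys and every finite sequence $o_1,\dots,o_m$ of arbitrarily intermixed insert and delete-min operations, executed from an empty heap, in which no key is inserted while the same key is present in the heap, there are real potentials $\Phi_0=0$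 and $\Phi_1,\dots,\Phi_m\ge 0$ such that for every $i=1,\dots,m$ $$c_i+\Phi_i-\Phi_{i-1}\le C\cdot g(n_i),$$ where $c_i$ is the actual cost of $o_i$ and $n_i$ is the number of items in the heap just before $o_i$. In particular, $\sum_{i=1}^m c_i\le C\sum_{i=1}^m g(n_i)$. -/

import Mathlib

namespace ForwardPairingHeap

/-- Rooted ordered trees of arbitrary degree with a key at every node; the children of a node are
listed from left to right. -/
inductive Tree (α : Type*) where
  | node (key : α) (children : List (Tree α)) : Tree α

/-- A heap is either empty or a single tree. -/
abbrev Heap (α : Type*) := Option (Tree α)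

mutual
/-- The keys stored in a tree, in preorder. -/
def Tree.keys {α : Type*} : Tree α → List α
  | .node a ts => a :: forestKeys ts
/-- The keys stored in a list of trees, in preorder. -/
def forestKeys {α : Type*} : List (Tree α) → List α
  | [] => []
  | t :: ts => t.keys ++ forestKeys ts
end

/-- The keys stored in a heap. -/
def Heap.keys {α : Type*} : Heap α → List α
  | none => []
  | some t => t.keys

/-- The number of items in a heap. -/
def Heap.size {α : Type*} (h : Heap α) : ℕ := (Heap.keys h).length

section Operations

variable {α : Type*} [LinearOrder α]

/-- Compare two roots; the tree with the greater root becomes the leftmost child of the smaller. -/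
def link : Tree α → Tree α → Tree α
  | .node a ts, .node b us =>
    if a < b then .node a (.node b us :: ts) else .node b (.node a ts :: us)

/-- The left-to-right pairing round, with the number of links it performs. -/
def pairingRound : List (Tree α) → List (Tree α) × ℕ
  | x :: y :: l => (link x y :: (pairingRound l).1, (pairingRound l).2 + 1)
  | [x] => ([x], 0)
  | [] => ([], 0)

/-- The left-to-right accumulation round, with the number of links it performs. The first argument
is the tree whose root is the current left-to-right minimum. -/
def accumulate : Tree α → List (Tree α) → Tree α × ℕ
  | p, [] => (p, 0)
  | p, y :: l => ((accumulate (link p y) l).1, (accumulate (link p y) l).2 + 1)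

/-- Consolidation of the children of a deleted root in the forward variant (a pairing round, then an
accumulation round, both from left to right), with the total number of links performed. -/
def consolidate (l : List (Tree α)) : Heap α × ℕ :=
  match pairingRound l with
  | ([], m) => (none, m)
  | (y :: ys, m) => (some (accumulate y ys).1, m + (accumulate y ys).2)

/-- Insertion of a key, with the number of links performed. -/
def insert (a : α) : Heap α → Heap α × ℕ
  | none => (some (.node a []), 0)
  | some t => (some (link (.node a []) t), 1)

/-- Deletion of the root, with the number of links performed. On the empty heap nothing happens. -/
def deleteMin : Heap α → Heap α × ℕ
  | none => (none, 0)
  | some (.node _ ts) => consolidate ts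

/-- The heap operations. -/
inductive Op (α : Type*) where
  | insert (a : α) : Op α
  | deleteMin : Op α

/-- Execution of an operation: the resulting heap, and the number of links performed. -/
def Op.exec : Op α → Heap α → Heap α × ℕ
  | .insert a, h => ForwardPairingHeap.insert a h
  | .deleteMin, h => ForwardPairingHeap.deleteMin h

/-- The actual cost of an operation: one unit for every link, and one unit for the call itself. -/
def Op.cost (o : Op α) (h : Heap α) : ℕ := 1 + (o.exec h).2

/-- The heap obtained from the empty heap by executing a sequence of operations. -/
def run (ops : List (Op α)) : Heap α := ops.foldl (fun h o => (o.exec h).1) none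

/-- Keys are unique: no key is inserted while the same key is present in the heap. -/
def UniqueKeys (ops : List (Op α)) : Prop :=
  ∀ (i : ℕ) (a : α), ops[i]? = some (Op.insert a) → a ∉ Heap.keys (run (ops.take i))

end Operations

/-- The function `log n * 4 ^ √(log n)` with binary logarithms, its value at `2` being used for
`n = 0` and `n = 1` (where the logarithm is undefined or zero). -/
noncomputable def bound (n : ℕ) : ℝ :=
  Real.logb 2 (max n 2 : ℕ) * (4 : ℝ) ^ Real.sqrt (Real.logb 2 (max n 2 : ℕ))

end ForwardPairingHeap

namespace ForwardPairingHeap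

-- Let `w = weight`. Every non-root node carries `w` of its subtree size minus `w` of its parent's
-- size just after their link; that size is recoverable because later children are placed further
-- left and non-root subtrees stay unchanged. Adding the root's weight gives `rooted`, and a link
-- lowers the total `rooted` by the winner's old weight (`rooted_link`).
--
-- In delete-min, undoing the links to the deleted root raises the total, but the pairing round
-- regains the winners' weights. Since `w` decreases slowly, the net loss of one pair is at most a
-- constant times a difference of logarithms of suffix sizes, and these telescope to `O(log n)`
-- (`pairingRound_spec`). Each accumulation link then gains at least `w n` (`accumulate_spec`).
-- Scaling by `2 / w n` turns this into two units per link, enough for both rounds, and turns the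
-- loss into `O(log n / w n)`, the claimed bound.

-- Analytic estimates for the weight

/-- The weight `4 ^ (-√(log n))` of a tree with `n` nodes. -/
noncomputable def weight (n : ℕ) : ℝ := (4 : ℝ) ^ (-Real.sqrt (Real.logb 2 n))

theorem weight_pos (n : ℕ) : 0 < weight n := Real.rpow_pos_of_pos (by norm_num) _

theorem weight_le_one (n : ℕ) : weight n ≤ 1 :=
  Real.rpow_le_one_of_one_le_of_nonpos (by norm_num) (neg_nonpos.2 (Real.sqrt_nonneg _))

theorem weight_one : weight 1 = 1 := by simp [weight]

theorem logb_two_mono {m n : ℕ} (h : m ≤ n) : Real.logb 2 m ≤ Real.logb 2 n := by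
  rcases Nat.eq_zero_or_pos m with rfl | hm
  · rcases Nat.eq_zero_or_pos n with rfl | hn
    · exact le_rfl
    · simpa using Real.logb_nonneg one_lt_two (by exact_mod_cast hn)
  · exact Real.logb_le_logb_of_le one_lt_two (by exact_mod_cast hm) (by exact_mod_cast h)

theorem weight_antitone : Antitone weight := fun _ _ h =>
  Real.rpow_le_rpow_of_exponent_le (by norm_num)
    (neg_le_neg (Real.sqrt_le_sqrt (logb_two_mono h)))

/-- Either `n` is so large that its weight is at most half of the weight of `m`, or `m / n` is at
least the weight of `n`. -/
theorem two_mul_weight_sub_le {m n : ℕ} (hm : 1 ≤ m) (hmn : m ≤ n) :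
    2 * weight n - weight m ≤ 2 * ((m : ℝ) / n) := by
  have hm0 : (0 : ℝ) < m := by exact_mod_cast hm
  have hn0 : (0 : ℝ) < n := by exact_mod_cast hm.trans hmn
  set x := Real.sqrt (Real.logb 2 n) with hx
  set y := Real.sqrt (Real.logb 2 m) with hy
  have hyx : y ≤ x := Real.sqrt_le_sqrt (logb_two_mono hmn)
  have hy0 : 0 ≤ y := Real.sqrt_nonneg _
  have hxx : x ^ 2 = Real.logb 2 n :=
    Real.sq_sqrt (Real.logb_nonneg one_lt_two (by exact_mod_cast hm.trans hmn))
  have hyy : y ^ 2 = Real.logb 2 m :=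
    Real.sq_sqrt (Real.logb_nonneg one_lt_two (by exact_mod_cast hm))
  have four_rpow : ∀ z : ℝ, (4 : ℝ) ^ (-z) = 2 ^ (-(2 * z)) := fun z => by
    rw [show (4 : ℝ) = 2 ^ (2 : ℝ) by norm_num, ← Real.rpow_mul (by norm_num)]
    ring_nf
  have hwn : weight n = 2 ^ (-(2 * x)) := four_rpow x
  have hwm : weight m = 2 ^ (-(2 * y)) := four_rpow y
  rcases le_total (1 / 2) (x - y) with h | h
  -- A gap of `1 / 2` between the square roots halves the weight, as `4 ^ (-1 / 2) = 1 / 2`.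
  · have : 2 * weight n ≤ weight m := by
      have h2 : (2 : ℝ) * 2 ^ (-(2 * x)) = 2 ^ (1 + -(2 * x)) := by
        rw [Real.rpow_add two_pos, Real.rpow_one]
      rw [hwn, hwm, h2]
      exact Real.rpow_le_rpow_of_exponent_le one_le_two (by linarith)
    have : (0 : ℝ) ≤ m / n := by positivity
    linarith
  -- Here `x ^ 2 - y ^ 2 = (x - y) * (x + y) ≤ x ≤ 2 * x`.
  · have hq : (m : ℝ) / n = 2 ^ (y ^ 2 - x ^ 2) := by
      rw [Real.rpow_sub two_pos, hxx, hyy, Real.rpow_logb two_pos (by norm_num) hm0,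
        Real.rpow_logb two_pos (by norm_num) hn0]
    have : weight n ≤ m / n := by
      rw [hwn, hq]
      exact Real.rpow_le_rpow_of_exponent_le one_le_two (by nlinarith)
    linarith [weight_pos m]

/-- If `m ≤ r`, replace `m + r` by `r` in the first weight and use `two_mul_weight_sub_le`;
otherwise the right side is at least `2`, and weights are at most `1`. -/
theorem weight_add_weight_sub_le {m r : ℕ} (hm : 1 ≤ m) (hr : 1 ≤ r) :
    weight (m + r) + weight r - weight m ≤ 4 * ((m : ℝ) / (m + r : ℕ)) := by
  have hm0 : (0 : ℝ) < m := by exact_mod_cast hm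
  have hr0 : (0 : ℝ) < r := by exact_mod_cast hr
  have hS : (0 : ℝ) < (m + r : ℕ) := by exact_mod_cast Nat.add_pos_left hm r
  rcases le_total m r with h | h
  · have h1 := two_mul_weight_sub_le hm h
    have h2 : weight (m + r) ≤ weight r := weight_antitone (Nat.le_add_left _ _)
    have h3 : 2 * ((m : ℝ) / r) ≤ 4 * ((m : ℝ) / (m + r : ℕ)) := by
      have h' : (m : ℝ) ≤ r := by exact_mod_cast h
      rw [← mul_div_assoc, ← mul_div_assoc, div_le_div_iff₀ hr0 hS]
      push_cast
      nlinarith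
    linarith
  · have h3 : 2 ≤ 4 * ((m : ℝ) / (m + r : ℕ)) := by
      have h' : (r : ℝ) ≤ m := by exact_mod_cast h
      rw [← mul_div_assoc, le_div_iff₀ hS]
      push_cast
      linarith
    linarith [weight_le_one (m + r), weight_le_one r, weight_pos m]

/-- This is `log t ≤ t - 1` at `t = r / (m + r)`; it makes the losses telescope. -/
theorem div_add_le_log_sub_log {m r : ℕ} (hr : 1 ≤ r) :
    (m : ℝ) / (m + r : ℕ) ≤ Real.log (m + r : ℕ) - Real.log r := by
  have hr0 : (0 : ℝ) < r := by exact_mod_cast hr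
  have hS : (0 : ℝ) < (m + r : ℕ) := by exact_mod_cast Nat.add_pos_right m hr
  have h := Real.log_le_sub_one_of_pos (div_pos hr0 hS)
  rw [Real.log_div hr0.ne' hS.ne'] at h
  have : (m : ℝ) / (m + r : ℕ) = 1 - r / (m + r : ℕ) := by
    field_simp
    push_cast
    ring
  linarith

theorem log_natCast_mono {m n : ℕ} (hm : 1 ≤ m) (h : m ≤ n) : Real.log m ≤ Real.log n :=
  Real.log_le_log (by exact_mod_cast hm) (by exact_mod_cast h)

/-- The loss in a link of the pairing round in which the left tree wins. -/
theorem weight_spans_sub_left_le {a b r : ℕ} (ha : 1 ≤ a) (hr : 1 ≤ r) :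
    weight (a + (b + r)) + weight (b + r) - weight a ≤
      4 * (Real.log (a + (b + r) : ℕ) - Real.log r) := by
  have hbr : 1 ≤ b + r := by omega
  linarith [weight_add_weight_sub_le ha hbr, div_add_le_log_sub_log (m := a) hbr,
    log_natCast_mono hr (Nat.le_add_left r b)]

/-- The loss in a link of the pairing round in which the right tree wins. -/
theorem weight_spans_sub_right_le {a b r : ℕ} (hb : 1 ≤ b) (hr : 1 ≤ r) :
    weight (a + (b + r)) + weight (b + r) - weight b ≤
      4 * (Real.log (a + (b + r) : ℕ) - Real.log r) := by
  have h1 := two_mul_weight_sub_le hb (Nat.le_add_right b r)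
  have h2 : weight (a + (b + r)) ≤ weight (b + r) := weight_antitone (Nat.le_add_left _ _)
  linarith [div_add_le_log_sub_log (m := b) hr, log_natCast_mono hr (Nat.le_add_left r b),
    log_natCast_mono (by omega : 1 ≤ b + r) (Nat.le_add_left (b + r) a)]

-- Sizes and the unscaled potential

/-- The number of nodes of a tree. -/
def Tree.size {α : Type*} (t : Tree α) : ℕ := t.keys.length

/-- The number of nodes of a forest. -/
def forestSize {α : Type*} (l : List (Tree α)) : ℕ := (forestKeys l).length

section Size

variable {α : Type*}

theorem Tree.size_node (a : α) (l : List (Tree α)) :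
    (Tree.node a l).size = 1 + forestSize l := by
  simp [Tree.size, forestSize, Tree.keys, Nat.add_comm]

theorem forestSize_nil : forestSize ([] : List (Tree α)) = 0 := by
  simp [forestSize, forestKeys]

theorem forestSize_cons (t : Tree α) (l : List (Tree α)) :
    forestSize (t :: l) = t.size + forestSize l := by
  simp [Tree.size, forestSize, forestKeys]

theorem Tree.one_le_size : ∀ t : Tree α, 1 ≤ t.size
  | .node a l => by rw [Tree.size_node]; omega

end Size

mutual
/-- The sum, over the non-root nodes of a tree, of the differences between the weight of the
subtree of the node, and the weight that the parent had when the node was linked to it. -/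
noncomputable def Tree.potential {α : Type*} : Tree α → ℝ
  | .node _ ts => forestPotential ts
/-- The potential of a tree, expressed by the list of the children of the root. -/
noncomputable def forestPotential {α : Type*} : List (Tree α) → ℝ
  | [] => 0
  | t :: ts =>
    t.potential + weight t.size - weight (t.size + (1 + forestSize ts)) + forestPotential ts
end

/-- The potential of a tree plus the weight of its root. -/
noncomputable def Tree.rooted {α : Type*} (t : Tree α) : ℝ := t.potential + weight t.size

section Potential

variable {α : Type*}

theorem Tree.potential_node (a : α) (l : List (Tree α)) :
    (Tree.node a l).potential = forestPotential l := by
  rw [Tree.potential]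

theorem forestPotential_nil : forestPotential ([] : List (Tree α)) = 0 := by
  rw [forestPotential]

theorem forestPotential_cons (t : Tree α) (l : List (Tree α)) :
    forestPotential (t :: l) =
      t.rooted - weight (t.size + (1 + forestSize l)) + forestPotential l := by
  rw [forestPotential, Tree.rooted]

mutual
theorem Tree.potential_nonneg : ∀ t : Tree α, 0 ≤ t.potential
  | .node a l => by
    rw [Tree.potential_node]
    exact forestPotential_nonneg l
theorem forestPotential_nonneg : ∀ l : List (Tree α), 0 ≤ forestPotential l
  | [] => by rw [forestPotential_nil]
  | t :: l => by
    have h1 := Tree.potential_nonneg t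
    have h2 := forestPotential_nonneg l
    have h3 : weight (t.size + (1 + forestSize l)) ≤ weight t.size :=
      weight_antitone (Nat.le_add_right _ _)
    rw [forestPotential_cons, Tree.rooted]
    linarith
end

mutual
-- Each non-root node contributes at most `1`. This limits the effect of rescaling at an insertion.
theorem Tree.potential_add_one_le_size : ∀ t : Tree α, t.potential + 1 ≤ t.size
  | .node a l => by
    have h := forestPotential_le_forestSize l
    rw [Tree.potential_node, Tree.size_node]
    push_cast
    linarith
theorem forestPotential_le_forestSize : ∀ l : List (Tree α), forestPotential l ≤ forestSize l
  | [] => by simp [forestPotential_nil, forestSize_nil]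
  | t :: l => by
    have h1 := Tree.potential_add_one_le_size t
    have h2 := forestPotential_le_forestSize l
    rw [forestPotential_cons, Tree.rooted, forestSize_cons]
    push_cast
    linarith [weight_le_one t.size, weight_pos (t.size + (1 + forestSize l))]
end

variable [LinearOrder α]

-- Effect of links and of the two rounds

/-- A link costs the weight of the winner. -/
theorem rooted_link (x y : Tree α) :
    (link x y).size = x.size + y.size ∧
      ((link x y).rooted = x.rooted + y.rooted - weight x.size ∨
        (link x y).rooted = x.rooted + y.rooted - weight y.size) := by
  obtain ⟨a, l⟩ := x
  obtain ⟨b, m⟩ := y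
  have hs : (link (.node a l) (.node b m)).size =
      (Tree.node a l).size + (Tree.node b m).size := by
    rw [link]
    split_ifs <;> simp only [Tree.size_node, forestSize_cons] <;> omega
  refine ⟨hs, ?_⟩
  rw [link] at hs ⊢
  split_ifs at hs ⊢
  · left
    rw [Tree.rooted, hs, Tree.potential_node, forestPotential_cons, ← Tree.size_node a,
      Nat.add_comm (Tree.node b m).size, Tree.rooted, Tree.rooted, Tree.potential_node a]
    ring
  · right
    rw [Tree.rooted, hs, Tree.potential_node, forestPotential_cons, ← Tree.size_node b,
      Tree.rooted, Tree.rooted, Tree.potential_node b]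
    ring

/-- The loss of a pair is bounded by the drop of `4 * log` across it, where the suffix size includes
the deleted root. The final `1` covers an unpaired last tree. -/
theorem pairingRound_spec : ∀ l : List (Tree α),
    forestSize (pairingRound l).1 = forestSize l ∧
    (pairingRound l).1.length + (pairingRound l).2 = l.length ∧
    (pairingRound l).2 ≤ (pairingRound l).1.length ∧
    ((pairingRound l).1.map Tree.rooted).sum ≤
      forestPotential l + 4 * Real.log (1 + forestSize l : ℕ) + 1
  | [] => by simp [pairingRound, forestPotential_nil, forestSize_nil]
  | [x] => by
    refine ⟨rfl, rfl, Nat.zero_le _, ?_⟩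
    have h1 := weight_le_one (x.size + (1 + forestSize ([] : List (Tree α))))
    have h2 : 0 ≤ Real.log (1 + forestSize [x] : ℕ) := Real.log_natCast_nonneg _
    simp only [pairingRound, List.map_cons, List.map_nil, List.sum_cons, List.sum_nil,
      forestPotential_cons, forestPotential_nil]
    linarith
  | x :: y :: l => by
    obtain ⟨h1, h2, h3, h4⟩ := pairingRound_spec l
    obtain ⟨hs, hr⟩ := rooted_link x y
    have hsz : 1 + forestSize (x :: y :: l) = x.size + (y.size + (1 + forestSize l)) := by
      simp only [forestSize_cons]
      omega
    refine ⟨?_, ?_, ?_, ?_⟩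
    · simp only [pairingRound, forestSize_cons, h1, hs]
      omega
    · simp only [pairingRound, List.length_cons]
      omega
    · simp only [pairingRound, List.length_cons]
      omega
    · have hx := weight_spans_sub_left_le (b := y.size) x.one_le_size
        (Nat.le_add_right 1 (forestSize l))
      have hy := weight_spans_sub_right_le (a := x.size) y.one_le_size
        (Nat.le_add_right 1 (forestSize l))
      rw [hsz]
      simp only [pairingRound, List.map_cons, List.sum_cons, forestPotential_cons]
      rw [show 1 + forestSize (y :: l) = y.size + (1 + forestSize l) by
        rw [forestSize_cons]; omega]
      rcases hr with hr | hr <;> linarith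

theorem accumulate_spec (n : ℕ) : ∀ (l : List (Tree α)) (p : Tree α),
    p.size + forestSize l ≤ n →
    (accumulate p l).1.size = p.size + forestSize l ∧
    (accumulate p l).2 = l.length ∧
    (accumulate p l).1.rooted ≤ p.rooted + (l.map Tree.rooted).sum - l.length * weight n
  | [], p, _ => by simp [accumulate, forestSize_nil]
  | y :: l, p, h => by
    rw [forestSize_cons] at h
    obtain ⟨hs, hr⟩ := rooted_link p y
    obtain ⟨h1, h2, h3⟩ := accumulate_spec n l (link p y) (by omega)
    have hp : weight n ≤ weight p.size := weight_antitone (by omega)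
    have hy : weight n ≤ weight y.size := weight_antitone (by omega)
    refine ⟨?_, ?_, ?_⟩
    · simp only [accumulate, h1, hs, forestSize_cons]
      omega
    · simp [accumulate, h2]
    · simp only [accumulate, List.map_cons, List.sum_cons, List.length_cons]
      push_cast
      rcases hr with hr | hr <;> linarith

end Potential

-- Scaled potential and amortized costs

/-- The potential of a heap before scaling. -/
noncomputable def Heap.basePotential {α : Type*} : Heap α → ℝ
  | none => 0
  | some t => t.potential

/-- The potential of a heap. -/
noncomputable def Heap.potential {α : Type*} (h : Heap α) : ℝ :=
  2 * ((weight (Heap.size h))⁻¹ * Heap.basePotential h)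

section Heap

variable {α : Type*}

theorem Heap.size_none : Heap.size (none : Heap α) = 0 := rfl

theorem Heap.size_some (t : Tree α) : Heap.size (some t) = t.size := rfl

theorem Heap.basePotential_nonneg (h : Heap α) : 0 ≤ Heap.basePotential h := by
  cases h with
  | none => exact le_rfl
  | some t => exact t.potential_nonneg

theorem Heap.potential_nonneg (h : Heap α) : 0 ≤ Heap.potential h :=
  mul_nonneg zero_le_two
    (mul_nonneg (inv_nonneg.2 (weight_pos _).le) (Heap.basePotential_nonneg h))

theorem inv_weight_mono {m n : ℕ} (h : m ≤ n) : (weight m)⁻¹ ≤ (weight n)⁻¹ :=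
  inv_anti₀ (weight_pos n) (weight_antitone h)

theorem one_le_inv_weight (n : ℕ) : 1 ≤ (weight n)⁻¹ :=
  (one_le_inv₀ (weight_pos n)).2 (weight_le_one n)

theorem bound_eq {n : ℕ} (hn : 2 ≤ n) : bound n = Real.logb 2 n * (weight n)⁻¹ := by
  rw [bound, weight, max_eq_left hn, Real.rpow_neg (by norm_num), inv_inv]

theorem bound_eq_four {n : ℕ} (hn : n ≤ 2) : bound n = 4 := by
  simp [bound, max_eq_right hn]

theorem one_le_logb {n : ℕ} (hn : 2 ≤ n) : 1 ≤ Real.logb 2 n := by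
  simpa using logb_two_mono hn

theorem inv_weight_le_bound {n : ℕ} (hn : 2 ≤ n) : (weight n)⁻¹ ≤ bound n := by
  rw [bound_eq hn]
  exact le_mul_of_one_le_left (inv_nonneg.2 (weight_pos n).le) (one_le_logb hn)

theorem log_mul_inv_weight_le_bound {n : ℕ} (hn : 2 ≤ n) :
    Real.log n * (weight n)⁻¹ ≤ bound n := by
  rw [bound_eq hn]
  refine mul_le_mul_of_nonneg_right ?_ (inv_nonneg.2 (weight_pos n).le)
  rw [Real.logb, le_div_iff₀ (Real.log_pos one_lt_two)]
  exact mul_le_of_le_one_right (Real.log_natCast_nonneg n)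
    (by linarith [Real.log_two_lt_d9])

/-- The scaling factor grows by a factor of at most `(n + 1) / n`. -/
theorem inv_weight_succ_le {n : ℕ} (hn : 2 ≤ n) :
    n * (weight (n + 1))⁻¹ ≤ (n + 1) * (weight n)⁻¹ := by
  have hn0 : (0 : ℝ) < n := by exact_mod_cast (by omega : 0 < n)
  have hn1 : (0 : ℝ) < (n + 1 : ℕ) := by exact_mod_cast Nat.succ_pos n
  set x := Real.sqrt (Real.logb 2 (n + 1 : ℕ)) with hx
  set y := Real.sqrt (Real.logb 2 n) with hy
  have hyx : y ≤ x := Real.sqrt_le_sqrt (logb_two_mono (Nat.le_succ n))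
  have hy1 : 1 ≤ y := Real.one_le_sqrt.2 (one_le_logb hn)
  have hxx : x ^ 2 = Real.logb 2 (n + 1 : ℕ) :=
    Real.sq_sqrt (zero_le_one.trans (one_le_logb (by omega)))
  have hyy : y ^ 2 = Real.logb 2 n := Real.sq_sqrt (zero_le_one.trans (one_le_logb hn))
  have inv_eq : ∀ z : ℝ, ((4 : ℝ) ^ (-z))⁻¹ = 2 ^ (2 * z) := fun z => by
    rw [Real.rpow_neg (by norm_num), inv_inv, Real.rpow_mul (by norm_num)]
    norm_num
  have h1 : (weight (n + 1))⁻¹ = 2 ^ (2 * x) := inv_eq x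
  have h2 : (weight n)⁻¹ = 2 ^ (2 * y) := inv_eq y
  have h3 : (n : ℝ) = 2 ^ (y ^ 2) := by rw [hyy, Real.rpow_logb two_pos (by norm_num) hn0]
  have h4 : (n : ℝ) + 1 = 2 ^ (x ^ 2) := by
    rw [hxx, Real.rpow_logb two_pos (by norm_num) hn1]
    push_cast
    rfl
  rw [h1, h2, h4, h3, ← Real.rpow_add two_pos, ← Real.rpow_add two_pos]
  -- The exponents compare because `z ^ 2 - 2 * z` is increasing for `z ≥ 1`; hence `2 ≤ n`.
  exact Real.rpow_le_rpow_of_exponent_le one_le_two (by nlinarith)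

variable [LinearOrder α]

theorem amortized_insert (a : α) (h : Heap α) :
    ((1 + (insert a h).2 : ℕ) : ℝ) + (Heap.potential (insert a h).1 - Heap.potential h) ≤
      10 * bound (Heap.size h) := by
  cases h with
  | none =>
    rw [Heap.size_none, bound_eq_four (by norm_num)]
    simp only [insert, Heap.potential, Heap.basePotential, Tree.potential_node,
      forestPotential_nil]
    norm_num
  | some t =>
    obtain ⟨hs, hr⟩ := rooted_link (.node a []) t
    have hone : (Tree.node a []).size = 1 := by rw [Tree.size_node, forestSize_nil]
    have hleaf : (Tree.node a []).rooted = 1 := by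
      rw [Tree.rooted, hone, weight_one, Tree.potential_node, forestPotential_nil, zero_add]
    rw [hone, hleaf] at hr
    rw [hone, Nat.add_comm] at hs
    have hle : (link (.node a []) t).potential ≤ t.potential + 1 := by
      simp only [Tree.rooted, hs] at hr
      have := weight_antitone t.one_le_size
      rcases hr with hr | hr <;> linarith [weight_pos (t.size + 1)]
    have hle' : (weight (t.size + 1))⁻¹ * (link (.node a []) t).potential ≤
        (weight (t.size + 1))⁻¹ * (t.potential + 1) :=
      mul_le_mul_of_nonneg_left hle (inv_nonneg.2 (weight_pos _).le)
    have hp := t.potential_add_one_le_size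
    have hp0 := t.potential_nonneg
    simp only [insert, Heap.potential, Heap.basePotential, Heap.size_some, hs]
    push_cast
    rcases Nat.lt_or_ge t.size 2 with h2 | h2
    · have h1 : t.size = 1 := by have := t.one_le_size; omega
      rw [h1] at hp hle' ⊢
      have h0 : t.potential = 0 := by push_cast at hp; linarith
      have hw : (weight (1 + 1))⁻¹ = 4 := by
        simp [weight, Real.rpow_neg]
      rw [h0, hw] at hle'
      rw [h0, hw, bound_eq_four (by norm_num)]
      linarith
    · have hM := inv_weight_succ_le h2
      have hb := inv_weight_le_bound h2
      have h1 := one_le_inv_weight t.size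
      have h2' : (2 : ℝ) ≤ t.size := by exact_mod_cast h2
      have hdiff : (t.size : ℝ) * ((weight (t.size + 1))⁻¹ - (weight t.size)⁻¹) ≤
          (weight t.size)⁻¹ := by linarith
      have hmono := inv_weight_mono (Nat.le_succ t.size)
      -- Rescaling the whole old potential thus costs at most one more `(weight t.size)⁻¹`.
      have hmul : (t.potential + 1) * ((weight (t.size + 1))⁻¹ - (weight t.size)⁻¹) ≤
          t.size * ((weight (t.size + 1))⁻¹ - (weight t.size)⁻¹) :=
        mul_le_mul_of_nonneg_right hp (sub_nonneg.2 hmono)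
      linarith

theorem amortized_deleteMin (h : Heap α) :
    ((1 + (deleteMin h).2 : ℕ) : ℝ) + (Heap.potential (deleteMin h).1 - Heap.potential h) ≤
      10 * bound (Heap.size h) := by
  rcases h with _ | ⟨a, l⟩
  · rw [Heap.size_none, bound_eq_four (by norm_num)]
    norm_num [deleteMin]
  obtain ⟨h1, h2, h3, h4⟩ := pairingRound_spec l
  simp only [deleteMin, consolidate]
  rw [Heap.size_some, Tree.size_node]
  rcases hl : pairingRound l with ⟨ys, m⟩
  rw [hl] at h1 h2 h3 h4
  rcases ys with _ | ⟨y, ys⟩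
  · have hm : m = 0 := by simpa using h3
    have hl0 : l = [] := by
      rw [← List.length_eq_zero_iff]
      simpa [hm] using h2.symm
    subst hl0
    rw [forestSize_nil, bound_eq_four (by norm_num)]
    simp only [Heap.potential, Heap.basePotential, Tree.potential_node, forestPotential_nil, hm]
    norm_num
  · simp only at h1 h2 h3 h4 ⊢
    rw [forestSize_cons] at h1
    obtain ⟨k1, k2, k3⟩ := accumulate_spec (1 + forestSize l) ys y (by omega)
    set t := (accumulate y ys).1
    set n := 1 + forestSize l
    rw [List.map_cons, List.sum_cons] at h4
    have hn : 2 ≤ n := by have := y.one_le_size; omega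
    have hw : weight n ≤ weight t.size := weight_antitone (by omega)
    -- The `+ 1` beside `ys.length` comes from discarding the new root's weight, which is at least
    -- `weight n`.
    have hbase : t.potential ≤
        forestPotential l + 4 * Real.log n + 1 - (ys.length + 1) * weight n := by
      rw [Tree.rooted] at k3
      linarith
    have hscale := mul_le_mul_of_nonneg_left hbase (inv_nonneg.2 (weight_pos n).le)
    have hcancel : (weight n)⁻¹ * ((ys.length + 1) * weight n) = ys.length + 1 := by
      field_simp [(weight_pos n).ne']
    have hshrink : (weight t.size)⁻¹ * t.potential ≤ (weight n)⁻¹ * t.potential :=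
      mul_le_mul_of_nonneg_right (inv_weight_mono (by omega)) t.potential_nonneg
    have hcost : ((1 + (m + (accumulate y ys).2) : ℕ) : ℝ) ≤ 2 * (ys.length + 1) := by
      rw [k2]
      rw [List.length_cons] at h3
      exact_mod_cast (by omega : 1 + (m + ys.length) ≤ 2 * (ys.length + 1))
    have hb := inv_weight_le_bound hn
    have hlog := log_mul_inv_weight_le_bound hn
    simp only [Heap.potential, Heap.basePotential, Heap.size_some, Tree.potential_node]
    rw [Tree.size_node]
    linarith

theorem amortized_exec (o : Op α) (h : Heap α) :
    (o.cost h : ℝ) + (Heap.potential (o.exec h).1 - Heap.potential h) ≤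
      10 * bound (Heap.size h) := by
  cases o with
  | insert a => exact amortized_insert a h
  | deleteMin => exact amortized_deleteMin h

theorem run_take_succ (ops : List (Op α)) (i : ℕ) (hi : i < ops.length) :
    run (ops.take (i + 1)) = (ops[i].exec (run (ops.take i))).1 := by
  rw [run, List.take_succ_eq_append_getElem hi, List.foldl_append]
  rfl

end Heap

end ForwardPairingHeap

/-- There is an absolute constant `C` such that for every sequence of insertions and deletions of
the minimum, starting from the empty heap, there are nonnegative potentials `Φ i` (after the first
`i` operations), with `Φ 0 = 0`, for which the amortized cost of every operation, that is, its actual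
cost plus the increase in potential, is at most `C * (log n * 4 ^ √(log n))`, where `n` is the number
of items in the heap when that operation is performed. -/
theorem theorem1 :
    ∃ C : ℝ, 0 < C ∧
      ∀ (α : Type*) [LinearOrder α] (ops : List (ForwardPairingHeap.Op α)),
        ForwardPairingHeap.UniqueKeys ops →
        ∃ Φ : ℕ → ℝ, Φ 0 = 0 ∧ (∀ i, 0 ≤ Φ i) ∧
          ∀ (i : ℕ) (hi : i < ops.length),
            ((ops[i].cost (ForwardPairingHeap.run (ops.take i)) : ℕ) : ℝ) + (Φ (i + 1) - Φ i) ≤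
              C * ForwardPairingHeap.bound
                (ForwardPairingHeap.Heap.size (ForwardPairingHeap.run (ops.take i))) := by
  -- Delete-min dictates `10 = 2 * (4 + 1)`: the scaling factor times the logarithmic and constant
  -- losses of the pairing round.
  refine ⟨10, by norm_num, fun α _ ops _ =>
    ⟨fun i => ForwardPairingHeap.Heap.potential (ForwardPairingHeap.run (ops.take i)), ?_,
      fun i => ForwardPairingHeap.Heap.potential_nonneg _, fun i hi => ?_⟩⟩
  · simp [ForwardPairingHeap.run, ForwardPairingHeap.Heap.potential,
      ForwardPairingHeap.Heap.basePotential]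
  · have h := ForwardPairingHeap.amortized_exec ops[i] (ForwardPairingHeap.run (ops.take i))
    rwa [← ForwardPairingHeap.run_take_succ ops i hi] at h
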